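/- Consider $n$ items; item $i$ arrives (event $A_i$) and is later deleted (event $D_i$). An admissible event sequence is an ordering of the $2n$ events $A_1,D_1,\dots,A_n,D_n$ in which $A_i$ comes before $D_i$ for every $i$; let all $(2n)!/2^n$ admissible event sequences be equally likely. For $0\le m\le 2n$ let $Y_{n,m}$ be the number of items stored after the first $m$ events, i.e. the number of arrivals minus the number of deletions among them, and let $Y^*_n=\max_{0\le m\le 2n}Y_{n,m}$. **Theorem.** As $n\to\infty$, $$n^{-1/2}\bigl(Y^*_n-n/2\bigr)\xrightarrow{d}N(0,1/4),$$ with convergence of all moments: with $W_n=n^{-1/2}(Y^*_n-n/2)$ and $W\sim N(0,1/4)$, $\mathbb E W_n^r\to\mathbb E W^r$ for every integer $r\ge0$ and $\mathbb E|W_n|^s\to\mathbb E|W|^s$ for every real $s>0$. In particular, $$\mathbb E\,Y^*_n=\frac n2+o(n^{1/2}),\qquad \operatorname{Var}Y^*_n=\frac n4+o(n).$$ -/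

import Mathlib

open MeasureTheory ProbabilityTheory Filter Topology Asymptotics

/-- The admissible event sequences of a priority queue with `n` items. The `2n` events are
`Sum.inl i` (the arrival `A_i`) and `Sum.inr i` (the deletion `D_i`) for `i : Fin n`. A sequence of
all the events is a bijection `e` from the positions `Fin (2 * n)` to the events, `e j` being the
event at position `j`; it is admissible if `A_i` comes before `D_i` for every item `i`. -/
def EventSequence (n : ℕ) : Type :=
  {e : Fin (2 * n) ≃ Fin n ⊕ Fin n // ∀ i : Fin n, e.symm (Sum.inl i) < e.symm (Sum.inr i)}

namespace EventSequence

variable {n : ℕ}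

instance : Fintype (EventSequence n) :=
  inferInstanceAs (Fintype
    {e : Fin (2 * n) ≃ Fin n ⊕ Fin n // ∀ i : Fin n, e.symm (Sum.inl i) < e.symm (Sum.inr i)})

/-- All `n` arrivals followed by all `n` deletions is an admissible sequence. -/
instance : Nonempty (EventSequence n) :=
  ⟨⟨(finCongr (two_mul n)).trans finSumFinEquiv.symm, fun i => by
    have h := i.isLt
    change (i : ℕ) < n + (i : ℕ)
    omega⟩⟩

instance : MeasurableSpace (EventSequence n) := ⊤

instance : MeasurableSingletonClass (EventSequence n) := ⟨fun _ => trivial⟩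

/-- `ω.queueSize m` is the number of items stored after the first `m` events: the number of
arrivals minus the number of deletions at the first `m` positions. -/
def queueSize (ω : EventSequence n) (m : ℕ) : ℤ :=
  ((Finset.univ.filter fun j : Fin (2 * n) => (j : ℕ) < m ∧ (ω.1 j).isLeft = true).card : ℤ) -
    ((Finset.univ.filter fun j : Fin (2 * n) => (j : ℕ) < m ∧ (ω.1 j).isRight = true).card : ℤ)

/-- The maximum queue size: the maximum of `ω.queueSize m` over `0 ≤ m ≤ 2n`. -/
def maxQueueSize (ω : EventSequence n) : ℤ :=
  (Finset.range (2 * n + 1)).sup' Finset.nonempty_range_add_one ω.queueSize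

/-- The random priority queue: all admissible event sequences are equally likely. -/
noncomputable def law (n : ℕ) : Measure (EventSequence n) :=
  uniformOn Set.univ

instance : IsProbabilityMeasure (law n) :=
  isProbabilityMeasure_uniformOn Set.finite_univ Set.univ_nonempty

/-- The normalized maximum queue size `n^{-1/2} (Y*_n - n/2)`. -/
noncomputable def normalizedMax (ω : EventSequence n) : ℝ :=
  (√(n : ℝ))⁻¹ * ((ω.maxQueueSize : ℝ) - (n : ℝ) / 2)

end EventSequence

/-! The queue size after `m` events is the number of items split by time `m`, that is, with exactly
one event among the first `m`. This count ignores which of an item's two events is called the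
arrival, so `expect_eventSequence_eq_expect_equiv` lets a uniform ordering of all `2n` events
replace a uniform admissible one.

Stop at an independent time `b` with law Bin(2n, 1/2). The events seen so far then form a uniformly
random set, so every event is in or out by a fair coin and the number of split items is exactly
Bin(n, 1/2) (`expect_expect_splitCount`). This gives the Gaussian limit and subgaussian moments at
time `b`.

It remains to show that the maximum exceeds the value at `b` by only o(√n), in every moment
(`tendsto_expect_gap_pow`). Since `b` is near `n`, where the mean profile peaks, increments away
from `b` have almost no upward drift. Their exponential moments are bounded by comparing sampling
without and with replacement (`expect_comp_symm_le`, at the cost of a polynomial factor) and then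
treating one item at a time (`pair_weight_le`). A union bound over `m` finishes the estimate.

Characteristic functions then give convergence in law, and bounded even moments upgrade it to
convergence of moments. -/

/-! ### Split items and the passage to arbitrary orderings -/

/-- The number of items whose arrival and deletion have different colours. -/
def bichromaticCount {n : ℕ} {K : Type*} [DecidableEq K] (T : Fin n ⊕ Fin n → K) : ℕ :=
  (Finset.univ.filter fun i : Fin n => T (Sum.inl i) ≠ T (Sum.inr i)).card

/-- The number of positions marked `true`. -/
def trueCount {N : ℕ} (T : Fin N → Bool) : ℕ := (Finset.univ.filter fun j => T j = true).card

/-- The indicator of the first `m` positions. -/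
def isInitial {N : ℕ} (m : ℕ) (j : Fin N) : Bool := decide ((j : ℕ) < m)

/-- The number of items exactly one of whose two events is among the first `m`, for an arbitrary
ordering of the events. -/
def splitCount {n : ℕ} (e : Fin (2 * n) ≃ Fin n ⊕ Fin n) (m : ℕ) : ℕ :=
  bichromaticCount (isInitial m ∘ e.symm)

/-- The maximum of `splitCount e m` over `0 ≤ m ≤ 2n`. -/
def maxSplitCount {n : ℕ} (e : Fin (2 * n) ≃ Fin n ⊕ Fin n) : ℕ :=
  (Finset.range (2 * n + 1)).sup' Finset.nonempty_range_add_one (splitCount e)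

theorem bichromaticCount_le {n : ℕ} {K : Type*} [DecidableEq K] (T : Fin n ⊕ Fin n → K) :
    bichromaticCount T ≤ n := by
  simpa [bichromaticCount] using Finset.card_filter_le (Finset.univ : Finset (Fin n))
    (fun i => T (Sum.inl i) ≠ T (Sum.inr i))

theorem splitCount_le {n : ℕ} (e : Fin (2 * n) ≃ Fin n ⊕ Fin n) (m : ℕ) : splitCount e m ≤ n :=
  bichromaticCount_le _

theorem maxSplitCount_le {n : ℕ} (e : Fin (2 * n) ≃ Fin n ⊕ Fin n) : maxSplitCount e ≤ n :=
  Finset.sup'_le _ _ fun m _ => splitCount_le e m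

theorem splitCount_le_maxSplitCount {n : ℕ} (e : Fin (2 * n) ≃ Fin n ⊕ Fin n) {m : ℕ}
    (hm : m ≤ 2 * n) : splitCount e m ≤ maxSplitCount e :=
  Finset.le_sup' (splitCount e) (by simpa using Nat.lt_succ_of_le hm)

theorem card_filter_lt_isLeft {n : ℕ} (e : Fin (2 * n) ≃ Fin n ⊕ Fin n) (m : ℕ) :
    (Finset.univ.filter fun j : Fin (2 * n) => (j : ℕ) < m ∧ (e j).isLeft = true).card =
      (Finset.univ.filter fun i : Fin n => (e.symm (Sum.inl i) : ℕ) < m).card := by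
  symm
  refine Finset.card_bij (fun i _ => e.symm (Sum.inl i)) ?_ ?_ ?_
  · intro i hi
    simpa using hi
  · intro i _ i' _ h
    simpa using h
  · intro j hj
    simp only [Finset.mem_filter, Finset.mem_univ, true_and, Sum.isLeft_iff] at hj
    obtain ⟨hj, i, hi⟩ := hj
    refine ⟨i, ?_, ?_⟩
    · simpa [← hi] using hj
    · simp [← hi]

theorem card_filter_lt_isRight {n : ℕ} (e : Fin (2 * n) ≃ Fin n ⊕ Fin n) (m : ℕ) :
    (Finset.univ.filter fun j : Fin (2 * n) => (j : ℕ) < m ∧ (e j).isRight = true).card =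
      (Finset.univ.filter fun i : Fin n => (e.symm (Sum.inr i) : ℕ) < m).card := by
  symm
  refine Finset.card_bij (fun i _ => e.symm (Sum.inr i)) ?_ ?_ ?_
  · intro i hi
    simpa using hi
  · intro i _ i' _ h
    simpa using h
  · intro j hj
    simp only [Finset.mem_filter, Finset.mem_univ, true_and, Sum.isRight_iff] at hj
    obtain ⟨hj, i, hi⟩ := hj
    refine ⟨i, ?_, ?_⟩
    · simpa [← hi] using hj
    · simp [← hi]

theorem EventSequence.queueSize_eq_splitCount {n : ℕ} (ω : EventSequence n) (m : ℕ) :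
    ω.queueSize m = splitCount ω.1 m := by
  unfold EventSequence.queueSize splitCount bichromaticCount
  rw [card_filter_lt_isLeft, card_filter_lt_isRight, Finset.card_filter, Finset.card_filter,
    Finset.card_filter]
  push_cast
  rw [← Finset.sum_sub_distrib]
  refine Finset.sum_congr rfl fun i _ => ?_
  have h : (ω.1.symm (Sum.inl i) : ℕ) < (ω.1.symm (Sum.inr i) : ℕ) := ω.2 i
  simp only [isInitial, Function.comp]
  by_cases h1 : (ω.1.symm (Sum.inl i) : ℕ) < m <;> by_cases h2 : (ω.1.symm (Sum.inr i) : ℕ) < m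
  · simp [h1, h2]
  · simp [h1, h2]
  -- Deletion among the first `m` but arrival not: excluded by admissibility.
  · omega
  · simp [h1, h2]

theorem EventSequence.maxQueueSize_eq_maxSplitCount {n : ℕ} (ω : EventSequence n) :
    ω.maxQueueSize = maxSplitCount ω.1 := by
  unfold EventSequence.maxQueueSize maxSplitCount
  rw [Finset.apply_sup'_eq_sup'_comp _ (Nat.cast : ℕ → ℤ) (fun a b => by simp)]
  congr 1
  funext m
  exact ω.queueSize_eq_splitCount m

/-- Exchange the arrival and the deletion of every item `i` with `s i = true`. -/
def exchangeEvents {n : ℕ} (s : Fin n → Bool) : Equiv.Perm (Fin n ⊕ Fin n) where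
  toFun x := x.elim (fun i => if s i then Sum.inr i else Sum.inl i)
    (fun i => if s i then Sum.inl i else Sum.inr i)
  invFun x := x.elim (fun i => if s i then Sum.inr i else Sum.inl i)
    (fun i => if s i then Sum.inl i else Sum.inr i)
  left_inv x := by rcases x with i | i <;> by_cases h : s i <;> simp [h]
  right_inv x := by rcases x with i | i <;> by_cases h : s i <;> simp [h]

theorem splitCount_trans_exchangeEvents {n : ℕ} (e : Fin (2 * n) ≃ Fin n ⊕ Fin n)
    (s : Fin n → Bool) (m : ℕ) : splitCount (e.trans (exchangeEvents s)) m = splitCount e m := by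
  unfold splitCount bichromaticCount
  congr 1
  ext i
  simp only [Finset.mem_filter, Finset.mem_univ, true_and]
  by_cases h : s i
  · simpa [exchangeEvents, h] using not_congr eq_comm
  · simp [exchangeEvents, h]

/-- An item must be exchanged precisely when its deletion comes first, so the choice is forced item
by item. -/
theorem existsUnique_admissible_trans_exchangeEvents {n : ℕ} (e : Fin (2 * n) ≃ Fin n ⊕ Fin n) :
    ∃! s : Fin n → Bool, ∀ i, (e.trans (exchangeEvents s)).symm (Sum.inl i) <
      (e.trans (exchangeEvents s)).symm (Sum.inr i) := by
  have key : ∀ (s : Fin n → Bool) (i : Fin n), ((e.trans (exchangeEvents s)).symm (Sum.inl i) <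
      (e.trans (exchangeEvents s)).symm (Sum.inr i)) ↔
      s i = decide (e.symm (Sum.inr i) < e.symm (Sum.inl i)) := by
    intro s i
    have hne : e.symm (Sum.inr i) ≠ e.symm (Sum.inl i) := by simp
    by_cases h : s i
    · simp [exchangeEvents, h]
    · simp only [Bool.not_eq_true] at h
      simp only [exchangeEvents, h, Equiv.symm_trans_apply, Equiv.coe_fn_symm_mk, Sum.elim_inl,
        Sum.elim_inr, eq_comm (a := false), decide_eq_false_iff_not, not_lt]
      exact ⟨le_of_lt, fun h => lt_of_le_of_ne h hne.symm⟩
  simp_rw [key]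
  exact ⟨fun i => decide (e.symm (Sum.inr i) < e.symm (Sum.inl i)), fun i => rfl,
    fun s hs => funext hs⟩

open Classical in
-- Attach to each ordering its unique correcting exchange and swap the sums: each of the `2 ^ n`
-- exchanges permutes the orderings, so each contributes the same sum over admissible ones.
theorem sum_equiv_eq_two_pow_mul_sum_eventSequence {n : ℕ} {R : Type*} [CommSemiring R]
    (H : (Fin (2 * n) ≃ Fin n ⊕ Fin n) → R)
    (hH : ∀ e s, H (e.trans (exchangeEvents s)) = H e) :
    ∑ e, H e = 2 ^ n * ∑ ω : EventSequence n, H ω.1 := by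
  let adm (e : Fin (2 * n) ≃ Fin n ⊕ Fin n) : Prop :=
    ∀ i : Fin n, e.symm (Sum.inl i) < e.symm (Sum.inr i)
  have h1 : ∀ e, H e = ∑ s : Fin n → Bool, if adm (e.trans (exchangeEvents s)) then
      H (e.trans (exchangeEvents s)) else 0 := by
    intro e
    obtain ⟨s, hs, hu⟩ := existsUnique_admissible_trans_exchangeEvents e
    rw [Finset.sum_eq_single s]
    · rw [if_pos hs, hH]
    · intro s' _ hne
      exact if_neg fun h => hne (hu s' h)
    · simp
  rw [Finset.sum_congr rfl fun e _ => h1 e, Finset.sum_comm]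
  have h2 : ∀ s : Fin n → Bool, (∑ e : Fin (2 * n) ≃ Fin n ⊕ Fin n,
      if adm (e.trans (exchangeEvents s)) then H (e.trans (exchangeEvents s)) else 0) =
      ∑ ω : EventSequence n, H ω.1 := by
    intro s
    have := (Equiv.equivCongr (Equiv.refl (Fin (2 * n))) (exchangeEvents s)).sum_comp
      (fun e => if adm e then H e else 0)
    rw [show (∑ e : Fin (2 * n) ≃ Fin n ⊕ Fin n,
      if adm (e.trans (exchangeEvents s)) then H (e.trans (exchangeEvents s)) else 0) =
        ∑ e, if adm e then H e else 0 from this, ← Finset.sum_filter]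
    exact Finset.sum_subtype _ (fun e => by simp [adm]) H
  rw [Finset.sum_congr rfl fun s _ => h2 s]
  simp

theorem expect_eventSequence_eq_expect_equiv {n : ℕ} {R : Type*} [Field R] [CharZero R]
    (H : (Fin (2 * n) ≃ Fin n ⊕ Fin n) → R)
    (hH : ∀ e s, H (e.trans (exchangeEvents s)) = H e) :
    Finset.expect Finset.univ (fun ω : EventSequence n => H ω.1) =
      Finset.expect Finset.univ H := by
  rw [Fintype.expect_eq_sum_div_card, Fintype.expect_eq_sum_div_card,
    sum_equiv_eq_two_pow_mul_sum_eventSequence H hH]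
  -- The constant function `1` compares the two cardinalities, so the factor `2 ^ n` cancels.
  have hc := sum_equiv_eq_two_pow_mul_sum_eventSequence (n := n) (R := R) (fun _ => 1)
    (fun _ _ => rfl)
  simp only [Finset.sum_const, Finset.card_univ, nsmul_eq_mul, mul_one] at hc
  rw [hc, mul_div_mul_left _ _ (pow_ne_zero _ two_ne_zero)]

/-! ### Sampling without replacement against sampling with replacement -/

/-- The Stirling sequence decreases from its first value `e / √2`. -/
theorem factorial_le_exp_one_mul_sqrt_mul {m : ℕ} (hm : m ≠ 0) :
    (m.factorial : ℝ) ≤ Real.exp 1 * √m * (m / Real.exp 1) ^ m := by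
  obtain ⟨k, rfl⟩ := Nat.exists_eq_succ_of_ne_zero hm
  have h := Stirling.stirlingSeq'_antitone (Nat.zero_le k)
  simp only [Function.comp, Nat.succ_eq_add_one, zero_add, Stirling.stirlingSeq_one] at h
  unfold Stirling.stirlingSeq at h
  have h2 : (0 : ℝ) < √2 := by positivity
  rw [div_le_div_iff₀ (by positivity) h2, Real.sqrt_mul (by norm_num)] at h
  have : ((k + 1).factorial : ℝ) * √2 ≤
      (Real.exp 1 * √((k + 1 : ℕ) : ℝ) * (((k + 1 : ℕ) : ℝ) / Real.exp 1) ^ (k + 1)) * √2 := by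
    linarith
  exact le_of_mul_le_mul_right this h2

/-- Using `√N` instead of `√m` makes the prefactor uniform over colour classes and covers empty
ones. -/
theorem factorial_mul_exp_le {m N : ℕ} (hmN : m ≤ N) (hN : N ≠ 0) :
    (m.factorial : ℝ) * Real.exp m ≤ Real.exp 1 * √N * (m : ℝ) ^ m := by
  have hN1 : (1 : ℝ) ≤ √N := by
    rw [Real.one_le_sqrt]; exact_mod_cast Nat.one_le_iff_ne_zero.2 hN
  rcases eq_or_ne m 0 with rfl | hm
  · have : (1 : ℝ) ≤ Real.exp 1 := Real.one_le_exp zero_le_one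
    simpa using one_le_mul_of_one_le_of_one_le this hN1
  · have h := factorial_le_exp_one_mul_sqrt_mul hm
    have he : Real.exp (m : ℝ) = Real.exp 1 ^ m := by rw [← Real.exp_nat_mul, mul_one]
    rw [div_pow, ← he, mul_div_assoc', le_div_iff₀ (Real.exp_pos _)] at h
    refine h.trans ?_
    gcongr

theorem pow_self_le_factorial_mul_exp (N : ℕ) : (N : ℝ) ^ N ≤ N.factorial * Real.exp N := by
  have h := Real.pow_div_factorial_le_exp (x := (N : ℝ)) (by positivity) N
  rwa [div_le_iff₀ (by positivity), mul_comm] at h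

/-- A lower bound on the mode of the multinomial distribution. -/
theorem prod_factorial_le {K : Type*} [Fintype K] {N : ℕ} (hN : N ≠ 0) (m : K → ℕ)
    (hm : ∑ k, m k = N) :
    (∏ k, ((m k).factorial : ℝ)) ≤
      N.factorial * (Real.exp 1 * √N) ^ Fintype.card K * ∏ k, ((m k : ℝ) / N) ^ m k := by
  have h1 : (∏ k, ((m k).factorial : ℝ)) * Real.exp N ≤
      (Real.exp 1 * √N) ^ Fintype.card K * ∏ k, (m k : ℝ) ^ m k := by
    have hs : Real.exp N = ∏ k, Real.exp (m k) := by
      rw [← Real.exp_sum, ← Nat.cast_sum, hm]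
    rw [hs, ← Finset.prod_mul_distrib]
    calc _ ≤ ∏ k, (Real.exp 1 * √N * (m k : ℝ) ^ m k) :=
          Finset.prod_le_prod (fun _ _ => by positivity) fun k _ =>
            factorial_mul_exp_le (hm ▸ Finset.single_le_sum (fun _ _ => Nat.zero_le _)
              (Finset.mem_univ k)) hN
      _ = _ := by rw [Finset.prod_mul_distrib, Finset.prod_const, Finset.card_univ]
  have h2 : ∏ k, ((m k : ℝ) / N) ^ m k = (∏ k, (m k : ℝ) ^ m k) / (N : ℝ) ^ N := by
    simp_rw [div_pow]
    rw [Finset.prod_div_distrib, Finset.prod_pow_eq_pow_sum, hm]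
  have hN0 : (0 : ℝ) < (N : ℝ) ^ N := by positivity
  rw [h2, mul_div_assoc', le_div_iff₀ hN0]
  calc _ ≤ (∏ k, ((m k).factorial : ℝ)) * (N.factorial * Real.exp N) := by
        gcongr; exact pow_self_le_factorial_mul_exp N
    _ = N.factorial * ((∏ k, ((m k).factorial : ℝ)) * Real.exp N) := by ring
    _ ≤ N.factorial * ((Real.exp 1 * √N) ^ Fintype.card K * ∏ k, (m k : ℝ) ^ m k) := by gcongr
    _ = _ := by ring

/-- The number of bijections transporting the colouring `c` to the colouring `T`. -/
theorem card_equiv_comp_symm_eq_le {P Ω K : Type*} [Fintype P] [Fintype Ω] [Fintype K]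
    [DecidableEq P] [DecidableEq Ω] [DecidableEq K]
    (c : P → K) (T : Ω → K) (hP : Fintype.card P ≠ 0) :
    ((Finset.univ.filter fun e : P ≃ Ω => c ∘ e.symm = T).card : ℝ) ≤
      (Fintype.card P).factorial * (Real.exp 1 * √(Fintype.card P)) ^ Fintype.card K *
        ∏ x, ((Fintype.card {j // c j = T x} : ℝ) / Fintype.card P) := by
  rcases (Finset.univ.filter fun e : P ≃ Ω => c ∘ e.symm = T).eq_empty_or_nonempty with h | ⟨e₀, h₀⟩
  · rw [h]; simp only [Finset.card_empty, Nat.cast_zero]; positivity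
  have hT : T = c ∘ e₀.symm := by simpa [eq_comm] using h₀
  subst hT
  have h1 : (Finset.univ.filter fun e : P ≃ Ω => c ∘ e.symm = c ∘ e₀.symm).card ≤
      ∏ k, (Fintype.card {j // c j = k}).factorial := by
    -- These bijections form a coset of the stabilizer of `c`, whose order is the product of
    -- factorials.
    rw [← DomMulAct.stabilizer_card (f := c), Fintype.card_subtype]
    refine Finset.card_le_card_of_injOn (fun e => e.trans e₀.symm) ?_ ?_
    · intro e he
      have he : c ∘ e.symm = c ∘ e₀.symm := by simpa using he
      simp only [Finset.coe_filter, Finset.mem_univ, true_and, Set.mem_ofPred_eq]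
      funext j
      have := congr_fun he (e j)
      simpa [eq_comm] using this
    · intro e _ e' _ h
      ext j
      have := congr_arg (fun g : Equiv.Perm P => e₀ (g j)) h
      simpa using this
  have h2 : ∏ x, ((Fintype.card {j // c j = (c ∘ e₀.symm) x} : ℝ) / Fintype.card P) =
      ∏ k, ((Fintype.card {j // c j = k} : ℝ) / Fintype.card P) ^ Fintype.card {j // c j = k} := by
    refine (Fintype.prod_equiv e₀.symm _
      (fun i => ((Fintype.card {j // c j = c i} : ℝ) / Fintype.card P)) fun _ => rfl).trans ?_
    rw [← Finset.prod_fiberwise Finset.univ c]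
    refine Finset.prod_congr rfl fun k _ => ?_
    rw [Finset.prod_congr rfl (g := fun _ => ((Fintype.card {j // c j = k} : ℝ) / Fintype.card P)),
      Finset.prod_const, Fintype.card_subtype]
    intro i hi
    rw [Finset.mem_filter] at hi
    rw [hi.2]
  rw [h2]
  refine le_trans (by exact_mod_cast h1) (prod_factorial_le hP _ ?_)
  rw [← Fintype.card_sigma]
  exact Fintype.card_congr (Equiv.sigmaFiberEquiv c)

/-- Sampling without replacement is dominated by sampling with replacement, up to a polynomial
factor. -/
theorem expect_comp_symm_le {P Ω K : Type*} [Fintype P] [Fintype Ω] [Fintype K]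
    [DecidableEq P] [DecidableEq Ω] [DecidableEq K]
    (c : P → K) (hP : Fintype.card P ≠ 0) (hcard : Fintype.card P = Fintype.card Ω)
    (G : (Ω → K) → ℝ) (hG : ∀ T, 0 ≤ G T) :
    Finset.expect Finset.univ (fun e : P ≃ Ω => G (c ∘ e.symm)) ≤
      (Real.exp 1 * √(Fintype.card P)) ^ Fintype.card K *
        ∑ T : Ω → K, G T * ∏ x, ((Fintype.card {j // c j = T x} : ℝ) / Fintype.card P) := by
  rw [Fintype.expect_eq_sum_div_card, Fintype.card_equiv (Fintype.equivOfCardEq hcard),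
    div_le_iff₀ (by positivity),
    ← Finset.sum_fiberwise Finset.univ (fun e : P ≃ Ω => c ∘ e.symm), Finset.mul_sum,
    Finset.sum_mul]
  refine Finset.sum_le_sum fun T _ => ?_
  rw [Finset.sum_congr rfl (g := fun _ => G T), Finset.sum_const, nsmul_eq_mul]
  · calc _ ≤ _ := mul_le_mul_of_nonneg_right (card_equiv_comp_symm_eq_le c T hP) (hG T)
      _ = _ := by ring
  · intro e he
    rw [Finset.mem_filter] at he
    rw [he.2]

/-! ### The binomial law at a binomial time -/

/-- Items are independent once all events are coloured independently, so the sum factors over items.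
-/
theorem sum_prod_pairs {n : ℕ} {K R : Type*} [Fintype K] [DecidableEq K] [CommSemiring R]
    (g : K → K → R) :
    ∑ T : Fin n ⊕ Fin n → K, ∏ i, g (T (Sum.inl i)) (T (Sum.inr i)) = (∑ a, ∑ b, g a b) ^ n := by
  rw [← Fintype.sum_prod_type' (fun a b => g a b), Fintype.sum_pow]
  refine Fintype.sum_equiv ((Equiv.sumArrowEquivProdArrow _ _ _).trans
    (Equiv.arrowProdEquivProdArrow _ _ _).symm) _ _ fun T => ?_
  rfl

theorem pow_bichromaticCount {n : ℕ} {K R : Type*} [DecidableEq K] [CommSemiring R]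
    (T : Fin n ⊕ Fin n → K) (u v : R) :
    u ^ (n - bichromaticCount T) * v ^ bichromaticCount T =
      ∏ i, if T (Sum.inl i) = T (Sum.inr i) then u else v := by
  rw [Finset.prod_ite, Finset.prod_const, Finset.prod_const]
  congr 2
  have := Finset.card_filter_add_card_filter_not (s := (Finset.univ : Finset (Fin n)))
    (fun i => T (Sum.inl i) = T (Sum.inr i))
  rw [Finset.card_univ, Fintype.card_fin] at this
  unfold bichromaticCount
  simp only [ne_eq] at *
  omega

theorem exists_perm_isInitial {N : ℕ} (T : Fin N → Bool) :
    ∃ σ : Equiv.Perm (Fin N),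
      T ∘ σ = isInitial (trueCount T) := by
  set b := trueCount T
  have hb : (Finset.univ.filter fun j => T j = true).card = b := rfl
  have hbN : b ≤ N := by
    simpa [hb] using Finset.card_le_univ (Finset.univ.filter fun j => T j = true)
  have hc : Fintype.card {j : Fin N // isInitial b j = true} =
      Fintype.card {j : Fin N // T j = true} := by
    rw [Fintype.card_subtype, Fintype.card_subtype, hb]
    simp only [isInitial, decide_eq_true_eq]
    rw [Fin.card_filter_val_lt, min_eq_right hbN]
  let f := Fintype.equivOfCardEq hc
  refine ⟨f.extendSubtype, funext fun j => ?_⟩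
  by_cases h : isInitial b j = true
  · simpa [h] using f.extendSubtype_mem j h
  · have := f.extendSubtype_not_mem j h
    simp only [Bool.not_eq_true] at h this
    simp [h, this]

/-- After a uniformly random binomial number of events, the number of split items is exactly
binomial. -/
theorem expect_expect_splitCount {n : ℕ} {R : Type*} [Field R] [CharZero R] (u v : R) :
    Finset.expect Finset.univ (fun e : Fin (2 * n) ≃ Fin n ⊕ Fin n =>
      Finset.expect Finset.univ (fun T : Fin (2 * n) → Bool =>
        u ^ (n - splitCount e (trueCount T)) *
          v ^ splitCount e (trueCount T))) =
      ((u + v) / 2) ^ n := by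
  have e₀ : Fin (2 * n) ≃ Fin n ⊕ Fin n := (finCongr (two_mul n)).trans finSumFinEquiv.symm
  have h1 : ∀ T : Fin (2 * n) → Bool,
      Finset.expect Finset.univ (fun e : Fin (2 * n) ≃ Fin n ⊕ Fin n =>
        u ^ (n - splitCount e (trueCount T)) *
          v ^ splitCount e (trueCount T)) =
      Finset.expect Finset.univ (fun e : Fin (2 * n) ≃ Fin n ⊕ Fin n =>
        u ^ (n - bichromaticCount (T ∘ e.symm)) * v ^ bichromaticCount (T ∘ e.symm)) := by
    intro T
    obtain ⟨σ, hσ⟩ := exists_perm_isInitial T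
    -- A permutation of positions preserves the uniform ordering, so an initial segment may be
    -- replaced by any set of the same size.
    refine Fintype.expect_equiv (Equiv.equivCongr σ (Equiv.refl _)) _ _ fun e => ?_
    unfold splitCount
    rw [← hσ]
    rfl
  have h2 : ∀ e : Fin (2 * n) ≃ Fin n ⊕ Fin n,
      Finset.expect Finset.univ (fun T : Fin (2 * n) → Bool =>
        u ^ (n - bichromaticCount (T ∘ e.symm)) * v ^ bichromaticCount (T ∘ e.symm)) =
      ((u + v) / 2) ^ n := by
    intro e
    have h := Fintype.expect_equiv (e.arrowCongr (Equiv.refl Bool))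
      (fun T : Fin (2 * n) → Bool =>
        u ^ (n - bichromaticCount (T ∘ e.symm)) * v ^ bichromaticCount (T ∘ e.symm))
      (fun T : Fin n ⊕ Fin n → Bool =>
        u ^ (n - bichromaticCount T) * v ^ bichromaticCount T) (fun T => rfl)
    rw [h, Fintype.expect_eq_sum_div_card]
    simp_rw [pow_bichromaticCount]
    rw [sum_prod_pairs (fun a b : Bool => if a = b then u else v)]
    simp only [Fintype.sum_bool, Fintype.card_fun, Fintype.card_bool, Fintype.card_sum,
      Fintype.card_fin, if_true, Bool.true_eq_false, Bool.false_eq_true, if_false]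
    push_cast
    rw [← two_mul, pow_mul, ← div_pow]
    congr 1
    ring
  rw [Finset.expect_comm, Finset.expect_congr rfl fun T _ => h1 T, Finset.expect_comm,
    Finset.expect_congr rfl fun e _ => h2 e]
  have : Nonempty (Fin (2 * n) ≃ Fin n ⊕ Fin n) := ⟨e₀⟩
  exact Fintype.expect_const _

/-! ### Exponential moments of increments -/

theorem exp_mul_splitCount_sub {n : ℕ} (l : ℝ) (e : Fin (2 * n) ≃ Fin n ⊕ Fin n) (m b : ℕ) :
    Real.exp (l * ((splitCount e m : ℝ) - splitCount e b)) =
      ∏ i : Fin n, Real.exp (l *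
        ((if isInitial m (e.symm (Sum.inl i)) ≠ isInitial m (e.symm (Sum.inr i)) then 1 else 0) -
          (if isInitial b (e.symm (Sum.inl i)) ≠ isInitial b (e.symm (Sum.inr i)) then 1 else 0))) := by
  rw [← Real.exp_sum, ← Finset.mul_sum, Finset.sum_sub_distrib]
  simp only [splitCount, bichromaticCount, Finset.card_filter, Nat.cast_sum, Nat.cast_ite,
    Nat.cast_one, Nat.cast_zero, Function.comp]

theorem exp_sub_one_le_add_sq {l : ℝ} (hl : |l| ≤ 1) : Real.exp l - 1 ≤ l + l ^ 2 := by
  have := (abs_le.1 (Real.abs_exp_sub_one_sub_id_le hl)).2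
  linarith

/-- The one-item moment generating function of the increment between two times, the second of
which is close to the middle. The four weights are the probabilities that an event is before both,
only before the first, only before the second, or after both times. -/
theorem pair_weight_le {l x y z w : ℝ} (hl0 : 0 ≤ l) (hl1 : l ≤ 1)
    (hx : 0 ≤ x) (hy : 0 ≤ y) (hz : 0 ≤ z) (hw : 0 ≤ w) (hs : x + y + z + w = 1)
    (hyz : y = 0 ∨ z = 0) (hb : |x + z - 1 / 2| ≤ l / 2) :
    1 + 2 * (Real.exp l - 1) * (x * z + y * w) + 2 * (Real.exp (-l) - 1) * (x * y + z * w) ≤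
      Real.exp (2 * l ^ 3) := by
  have h1 := exp_sub_one_le_add_sq (l := l) (by rw [abs_of_nonneg hl0]; exact hl1)
  have h2 := exp_sub_one_le_add_sq (l := -l) (by rw [abs_neg, abs_of_nonneg hl0]; exact hl1)
  have h3 : (Real.exp l - 1) * (x * z + y * w) ≤ (l + l ^ 2) * (x * z + y * w) :=
    mul_le_mul_of_nonneg_right h1 (by positivity)
  have h4 : (Real.exp (-l) - 1) * (x * y + z * w) ≤ (-l + (-l) ^ 2) * (x * y + z * w) :=
    mul_le_mul_of_nonneg_right h2 (by positivity)
  -- If `y = 0`, closeness to the middle gives `x - w ≤ l - z`, so the bracket is at most `2lz - z²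
  -- ≤ l²`: the negative curvature absorbs the drift. The case `z = 0` is symmetric.
  have h5 : l * ((x - w) * (z - y) + l * ((x + w) * (y + z))) ≤ l * l ^ 2 := by
    refine mul_le_mul_of_nonneg_left ?_ hl0
    obtain ⟨hb1, hb2⟩ := abs_le.1 hb
    rcases hyz with rfl | rfl
    · have e1 : l * ((x + w) * (0 + z)) ≤ l * (1 * z) := by gcongr <;> linarith
      have e2 : (x - w) * (z - 0) ≤ (l - z) * z := by
        rw [sub_zero]; exact mul_le_mul_of_nonneg_right (by linarith) hz
      nlinarith [sq_nonneg (l - z)]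
    · have e1 : l * ((x + w) * (y + 0)) ≤ l * (1 * y) := by gcongr <;> linarith
      have e2 : (w - x) * y ≤ (l - y) * y := mul_le_mul_of_nonneg_right (by linarith) hy
      nlinarith [sq_nonneg (l - y)]
  have h6 := Real.add_one_le_exp (2 * l ^ 3)
  nlinarith

theorem card_isInitial {N m : ℕ} (hm : m ≤ N) :
    (Finset.univ.filter fun j : Fin N => isInitial m j = true).card = m := by
  simp only [isInitial, decide_eq_true_eq]
  rw [Fin.card_filter_val_lt, min_eq_right hm]

/-- Colour each position by whether it precedes `m` and whether it precedes `b`. The four colours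
account for the fourth power in the comparison factor; the rest is the `n`-th power of the one-item
bound. -/
theorem expect_exp_splitCount_sub_le {n : ℕ} (hn : n ≠ 0) {l : ℝ} (hl0 : 0 ≤ l) (hl1 : l ≤ 1)
    {m b : ℕ} (hb : b ≤ 2 * n) (hbl : |(b : ℝ) - n| ≤ n * l) :
    Finset.expect Finset.univ (fun e : Fin (2 * n) ≃ Fin n ⊕ Fin n =>
      Real.exp (l * ((splitCount e m : ℝ) - splitCount e b))) ≤
      (Real.exp 1 * √(2 * n)) ^ 4 * Real.exp (2 * n * l ^ 3) := by
  have hn' : (0 : ℝ) < n := by positivity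
  let g : Bool × Bool → Bool × Bool → ℝ := fun a a' => Real.exp (l *
        ((if a.1 ≠ a'.1 then 1 else 0) - (if a.2 ≠ a'.2 then 1 else 0)))
  let c : Fin (2 * n) → Bool × Bool := fun j => (isInitial m j, isInitial b j)
  let p : Bool × Bool → ℝ := fun k => (Fintype.card {j // c j = k} : ℝ) / (2 * n : ℕ)
  have h1 := expect_comp_symm_le (Ω := Fin n ⊕ Fin n) c (by simpa using hn) (by simp; ring)
    (fun T => ∏ i, g (T (Sum.inl i)) (T (Sum.inr i)))
    (fun T => Finset.prod_nonneg fun _ _ => (Real.exp_pos _).le)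
  simp only [Fintype.card_fin, Fintype.card_prod, Fintype.card_bool] at h1
  have h2 : ∑ T : Fin n ⊕ Fin n → Bool × Bool, (∏ i, g (T (Sum.inl i)) (T (Sum.inr i))) *
      ∏ x, ((Fintype.card {j // c j = T x} : ℝ) / (2 * n : ℕ)) =
      (∑ a, ∑ a', g a a' * (p a * p a')) ^ n := by
    rw [← sum_prod_pairs]
    refine Finset.sum_congr rfl fun T _ => ?_
    rw [Fintype.prod_sum_type, ← Finset.prod_mul_distrib, ← Finset.prod_mul_distrib]
  rw [h2] at h1
  simp_rw [exp_mul_splitCount_sub]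
  refine h1.trans ?_
  have hp : ∀ k, 0 ≤ p k := fun k => by positivity
  have hcard : ∀ k, p k = ((Finset.univ.filter fun j => c j = k).card : ℝ) / (2 * n) := by
    intro k
    simp only [p]
    rw [Fintype.card_subtype]
    push_cast
    rfl
  have hsplit : ∀ (q : Fin (2 * n) → Prop) [DecidablePred q] (s : Fin (2 * n) → Bool),
      (Finset.univ.filter q).card = (Finset.univ.filter fun j => q j ∧ s j = true).card +
        (Finset.univ.filter fun j => q j ∧ s j = false).card := by
    intro q _ s
    have := Finset.card_filter_add_card_filter_not (s := Finset.univ.filter q) (fun j => s j = true)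
    rw [Finset.filter_filter, Finset.filter_filter] at this
    simpa using this.symm
  have hb1 : (b : ℝ) / (2 * n) = p (true, true) + p (false, true) := by
    rw [hcard, hcard, ← add_div, ← Nat.cast_add]
    congr 2
    conv_lhs => rw [← card_isInitial hb, hsplit _ (isInitial m)]
    congr 2 <;> · ext j; simp [c, and_comm]
  have hsum : p (true, true) + p (true, false) + p (false, true) + p (false, false) = 1 := by
    have : (2 * n : ℕ) = (Finset.univ.filter fun j => c j = (true, true)).card +
        (Finset.univ.filter fun j => c j = (true, false)).card +
        (Finset.univ.filter fun j => c j = (false, true)).card +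
        (Finset.univ.filter fun j => c j = (false, false)).card := by
      have h0 : (Finset.univ.filter fun _ : Fin (2 * n) => True).card = 2 * n := by simp
      conv_lhs => rw [← h0]
      rw [hsplit _ (isInitial m), hsplit _ (isInitial b),
        hsplit (fun j => True ∧ isInitial m j = false) (isInitial b), ← add_assoc]
      simp [c]
    simp only [hcard, ← add_div, ← Nat.cast_add, ← this]
    push_cast
    rw [div_self (by positivity)]
  have hyz : p (true, false) = 0 ∨ p (false, true) = 0 := by
    simp only [hcard]
    rcases le_total m b with h | h
    · left
      rw [Finset.filter_eq_empty_iff.2]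
      · simp
      · intro j _
        simp only [c, isInitial, Prod.mk.injEq, decide_eq_true_eq, decide_eq_false_iff_not]
        omega
    · right
      rw [Finset.filter_eq_empty_iff.2]
      · simp
      · intro j _
        simp only [c, isInitial, Prod.mk.injEq, decide_eq_true_eq, decide_eq_false_iff_not]
        omega
  have hb2 : |p (true, true) + p (false, true) - 1 / 2| ≤ l / 2 := by
    rw [← hb1, show (b : ℝ) / (2 * n) - 1 / 2 = (b - n) / (2 * n) by field_simp, abs_div,
      abs_of_pos (by positivity : (0 : ℝ) < 2 * n), div_le_iff₀ (by positivity)]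
    linarith
  have h3 := pair_weight_le hl0 hl1 (hp (true, true)) (hp (true, false)) (hp (false, true))
    (hp (false, false)) hsum hyz hb2
  have h4 : ∑ a, ∑ a', g a a' * (p a * p a') ≤ Real.exp (2 * l ^ 3) := by
    refine le_trans (le_of_eq ?_) h3
    -- The squared total mass turns the one-item sum into the form `1 + ...` of `pair_weight_le`.
    have hsq : (p (true, true) + p (true, false) + p (false, true) + p (false, false)) ^ 2 = 1 := by
      rw [hsum, one_pow]
    simp only [Fintype.sum_prod_type, Fintype.sum_bool, g]
    norm_num
    linear_combination hsq
  calc _ ≤ (Real.exp 1 * √((2 * n : ℕ) : ℝ)) ^ (2 * 2) * Real.exp (2 * l ^ 3) ^ n := by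
        gcongr
    _ = _ := by
        rw [← Real.exp_nat_mul, Nat.cast_mul, Nat.cast_ofNat]
        ring_nf

/-! ### The gap between the maximum and the value at the random time -/

instance nonempty_equiv_events {n : ℕ} : Nonempty (Fin (2 * n) ≃ Fin n ⊕ Fin n) :=
  ⟨(finCongr (two_mul n)).trans finSumFinEquiv.symm⟩

theorem trueCount_le {N : ℕ} (T : Fin N → Bool) : trueCount T ≤ N := by
  simpa [trueCount] using Finset.card_le_univ (Finset.univ.filter fun j => T j = true)

/-- The centred count is a sum of `2n` independent signs `±1/2`, each with exponential moment `cosh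
(s / 2)`. -/
theorem expect_exp_trueCount_le (n : ℕ) (s : ℝ) :
    Finset.expect Finset.univ (fun T : Fin (2 * n) → Bool =>
      Real.exp (s * ((trueCount T : ℝ) - n))) ≤ Real.exp (n * s ^ 2 / 4) := by
  have h1 : ∀ T : Fin (2 * n) → Bool, Real.exp (s * ((trueCount T : ℝ) - n)) =
      ∏ j, (fun b : Bool => Real.exp (if b = true then s / 2 else -(s / 2))) (T j) := by
    intro T
    rw [← Real.exp_sum]
    congr 1
    have : ∀ j, (if T j = true then s / 2 else -(s / 2)) =
        s * (if T j = true then (1 : ℝ) else 0) - s / 2 := by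
      intro j; split_ifs <;> ring
    simp_rw [this]
    rw [Finset.sum_sub_distrib, ← Finset.mul_sum]
    simp only [trueCount, Finset.card_filter, Finset.sum_const, Finset.card_univ, Fintype.card_fin]
    push_cast
    ring
  have h2 : (Real.exp (s / 2) + Real.exp (-(s / 2))) / 2 = Real.cosh (s / 2) :=
    (Real.cosh_eq _).symm
  rw [Fintype.expect_eq_sum_div_card]
  simp_rw [h1]
  rw [← Fintype.sum_pow (fun b : Bool => Real.exp (if b = true then s / 2 else -(s / 2))),
    Fintype.sum_bool, Fintype.card_fun, Fintype.card_bool, Fintype.card_fin]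
  push_cast
  rw [← div_pow]
  simp only [if_true]
  rw [h2]
  calc _ ≤ Real.exp ((s / 2) ^ 2 / 2) ^ (2 * n) := by
        gcongr
        exact Real.cosh_le_exp_half_sq _
    _ = _ := by
        rw [← Real.exp_nat_mul]; push_cast; ring_nf

theorem exists_splitCount_eq_maxSplitCount {n : ℕ} (e : Fin (2 * n) ≃ Fin n ⊕ Fin n) :
    ∃ m ∈ Finset.range (2 * n + 1), splitCount e m = maxSplitCount e := by
  obtain ⟨m, hm, h⟩ := Finset.exists_mem_eq_sup' (s := Finset.range (2 * n + 1))
    Finset.nonempty_range_add_one (splitCount e)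
  exact ⟨m, hm, h.symm⟩

/-- A gap above `u` is still at most `n`, and it forces either `b` to be farther than `n * l` from
the middle or some increment to exceed `u`. Both events are dominated by exponentials as in
Chernoff's bound; the `if` keeps increments only where their moment bound is available. -/
theorem gap_pow_le {n : ℕ} {l u : ℝ} (hl0 : 0 ≤ l) (k : ℕ) (b : ℕ) (hb : b ≤ 2 * n)
    (e : Fin (2 * n) ≃ Fin n ⊕ Fin n) :
    ((maxSplitCount e : ℝ) - splitCount e b) ^ k ≤
      |u| ^ k + n ^ k * ((Real.exp (l * ((b : ℝ) - n)) + Real.exp (-l * ((b : ℝ) - n))) *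
        Real.exp (-(n * l ^ 2)) +
        ∑ m ∈ Finset.range (2 * n + 1), (if |(b : ℝ) - n| ≤ n * l then
          Real.exp (l * ((splitCount e m : ℝ) - splitCount e b)) else 0) *
            Real.exp (-(l * u))) := by
  have h0 : (0 : ℝ) ≤ (maxSplitCount e : ℝ) - splitCount e b :=
    sub_nonneg.2 (by exact_mod_cast splitCount_le_maxSplitCount e hb)
  have h1 : (maxSplitCount e : ℝ) - splitCount e b ≤ n := by
    have : (maxSplitCount e : ℝ) ≤ n := by exact_mod_cast maxSplitCount_le e
    have : (0 : ℝ) ≤ splitCount e b := by positivity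
    linarith
  have hS : 0 ≤ ∑ m ∈ Finset.range (2 * n + 1), (if |(b : ℝ) - n| ≤ n * l then
          Real.exp (l * ((splitCount e m : ℝ) - splitCount e b)) else 0) *
            Real.exp (-(l * u)) :=
    Finset.sum_nonneg fun m _ => by positivity
  have hE : 0 ≤ (Real.exp (l * ((b : ℝ) - n)) + Real.exp (-l * ((b : ℝ) - n))) *
        Real.exp (-(n * l ^ 2)) := by positivity
  have hu : (0 : ℝ) ≤ |u| ^ k := by positivity
  have hnk : (0 : ℝ) ≤ (n : ℝ) ^ k := by positivity
  by_cases hgap : (maxSplitCount e : ℝ) - splitCount e b ≤ u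
  · have : ((maxSplitCount e : ℝ) - splitCount e b) ^ k ≤ |u| ^ k := by
      gcongr
      exact hgap.trans (le_abs_self u)
    have := mul_nonneg hnk (add_nonneg hE hS)
    linarith
  have hpow : ((maxSplitCount e : ℝ) - splitCount e b) ^ k ≤ (n : ℝ) ^ k := by gcongr
  refine hpow.trans ?_
  suffices h : 1 ≤ (Real.exp (l * ((b : ℝ) - n)) + Real.exp (-l * ((b : ℝ) - n))) *
        Real.exp (-(n * l ^ 2)) +
        ∑ m ∈ Finset.range (2 * n + 1), (if |(b : ℝ) - n| ≤ n * l then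
          Real.exp (l * ((splitCount e m : ℝ) - splitCount e b)) else 0) *
            Real.exp (-(l * u)) by
    have := mul_le_mul_of_nonneg_left h hnk
    linarith
  by_cases hbl : |(b : ℝ) - n| ≤ n * l
  · simp only [if_pos hbl] at hS ⊢
    obtain ⟨m, hm, hmax⟩ := exists_splitCount_eq_maxSplitCount e
    have h2 := Finset.single_le_sum (f := fun m =>
      Real.exp (l * ((splitCount e m : ℝ) - splitCount e b)) * Real.exp (-(l * u)))
      (fun _ _ => by positivity) hm
    have h3 : 1 ≤ Real.exp (l * ((splitCount e m : ℝ) - splitCount e b)) *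
        Real.exp (-(l * u)) := by
      rw [← Real.exp_add, hmax]
      apply Real.one_le_exp
      nlinarith
    linarith
  · have h4 : 1 ≤ (Real.exp (l * ((b : ℝ) - n)) + Real.exp (-l * ((b : ℝ) - n))) *
        Real.exp (-(n * l ^ 2)) := by
      rw [add_mul, ← Real.exp_add, ← Real.exp_add]
      rcases lt_abs.1 (not_le.1 hbl) with h | h
      · have : 1 ≤ Real.exp (l * ((b : ℝ) - n) + -(n * l ^ 2)) := Real.one_le_exp (by nlinarith)
        linarith [Real.exp_pos (-l * ((b : ℝ) - n) + -(n * l ^ 2))]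
      · have : 1 ≤ Real.exp (-l * ((b : ℝ) - n) + -(n * l ^ 2)) := Real.one_le_exp (by nlinarith)
        linarith [Real.exp_pos (l * ((b : ℝ) - n) + -(n * l ^ 2))]
    linarith

theorem expect_gap_pow_le {n : ℕ} (hn : n ≠ 0) {l u : ℝ} (hl0 : 0 ≤ l) (hl1 : l ≤ 1) (k : ℕ) :
    Finset.expect Finset.univ (fun e : Fin (2 * n) ≃ Fin n ⊕ Fin n =>
      Finset.expect Finset.univ (fun T : Fin (2 * n) → Bool =>
        ((maxSplitCount e : ℝ) - splitCount e (trueCount T)) ^ k)) ≤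
      |u| ^ k + n ^ k * (2 * Real.exp (-(3 / 4 * (n * l ^ 2))) +
        (2 * n + 1) * ((Real.exp 1 * √(2 * n)) ^ 4 * Real.exp (2 * n * l ^ 3)) *
          Real.exp (-(l * u))) := by
  rw [Finset.expect_comm]
  have h1 : ∀ T : Fin (2 * n) → Bool,
      Finset.expect Finset.univ (fun e : Fin (2 * n) ≃ Fin n ⊕ Fin n =>
        ((maxSplitCount e : ℝ) - splitCount e (trueCount T)) ^ k) ≤
      |u| ^ k + n ^ k * ((Real.exp (l * ((trueCount T : ℝ) - n)) +
        Real.exp (-l * ((trueCount T : ℝ) - n))) * Real.exp (-(n * l ^ 2)) +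
        (2 * n + 1) * ((Real.exp 1 * √(2 * n)) ^ 4 * Real.exp (2 * n * l ^ 3)) *
          Real.exp (-(l * u))) := by
    intro T
    refine (Finset.expect_le_expect fun e _ =>
      gap_pow_le (u := u) hl0 k (trueCount T) (trueCount_le T) e).trans ?_
    rw [Finset.expect_add_distrib, Fintype.expect_const, ← Finset.mul_expect,
      Finset.expect_add_distrib, Fintype.expect_const, Finset.expect_sum_comm]
    gcongr
    have h2 : ∀ m ∈ Finset.range (2 * n + 1),
        Finset.expect Finset.univ (fun e : Fin (2 * n) ≃ Fin n ⊕ Fin n =>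
          (if |(trueCount T : ℝ) - n| ≤ n * l then
          Real.exp (l * ((splitCount e m : ℝ) - splitCount e (trueCount T))) else 0) *
            Real.exp (-(l * u))) ≤
        ((Real.exp 1 * √(2 * n)) ^ 4 * Real.exp (2 * n * l ^ 3)) * Real.exp (-(l * u)) := by
      intro m _
      rw [← Finset.expect_mul]
      gcongr
      by_cases hbl : |(trueCount T : ℝ) - n| ≤ n * l
      · simp only [if_pos hbl]
        exact expect_exp_splitCount_sub_le hn hl0 hl1 (trueCount_le T) hbl
      · simp only [if_neg hbl, Finset.expect_const_zero]
        positivity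
    refine (Finset.sum_le_sum h2).trans (le_of_eq ?_)
    rw [Finset.sum_const, Finset.card_range, nsmul_eq_mul]
    push_cast
    ring
  refine (Finset.expect_le_expect fun T _ => h1 T).trans ?_
  rw [Finset.expect_add_distrib, Fintype.expect_const, ← Finset.mul_expect,
    Finset.expect_add_distrib, Fintype.expect_const, ← Finset.expect_mul,
    Finset.expect_add_distrib]
  have h3 := expect_exp_trueCount_le n l
  have h4 := expect_exp_trueCount_le n (-l)
  rw [neg_sq] at h4
  have h5 : Real.exp (n * l ^ 2 / 4) * Real.exp (-(n * l ^ 2)) =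
      Real.exp (-(3 / 4 * (n * l ^ 2))) := by
    rw [← Real.exp_add]
    ring_nf
  rw [← h5, ← mul_assoc 2, two_mul (Real.exp _)]
  gcongr

theorem expect_gap_pow_le_of_eq_pow {n k : ℕ} (hk : k ≠ 0) {x : ℝ} (hx : 2 ≤ x)
    (hnx : (n : ℝ) = x ^ 16) :
    Finset.expect Finset.univ (fun e : Fin (2 * n) ≃ Fin n ⊕ Fin n =>
      Finset.expect Finset.univ (fun T : Fin (2 * n) → Bool =>
        (((maxSplitCount e : ℝ) - splitCount e (trueCount T)) / √n) ^ k)) ≤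
      x⁻¹ + (2 + 12 * Real.exp 6) * (x ^ (8 * k + 48) * Real.exp (-x)) := by
  have hx0 : 0 < x := by linarith
  have hx1 : 1 ≤ x := by linarith
  have hn : n ≠ 0 := by
    rintro rfl
    have : 0 < x ^ 16 := by positivity
    simp at hnx
    linarith
  have hsq : √(n : ℝ) = x ^ 8 := by
    rw [hnx, show x ^ 16 = (x ^ 8) ^ 2 by ring, Real.sqrt_sq (by positivity)]
  have hsq2 : √(2 * (n : ℝ)) ^ 4 = 4 * x ^ 32 := by
    rw [show √(2 * (n : ℝ)) ^ 4 = (√(2 * (n : ℝ)) ^ 2) ^ 2 by ring, Real.sq_sqrt (by positivity),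
      hnx]
    ring
  -- Thus `l = n^(-3/8)` and `u = n^(7/16)`: `n * l ^ 2 = x ^ 4` and `l * u = x` are large, `n * l ^
  -- 3 = x⁻²` stays bounded, and `u / √n = x⁻¹` is small.
  have h := expect_gap_pow_le hn (l := (x ^ 6)⁻¹) (u := x ^ 7) (by positivity)
    (inv_le_one_of_one_le₀ (one_le_pow₀ hx1)) k
  simp_rw [div_pow, ← Finset.expect_div]
  rw [div_le_iff₀ (by rw [hsq]; positivity)]
  refine h.trans ?_
  have e1 : (n : ℝ) * (x ^ 6)⁻¹ ^ 2 = x ^ 4 := by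
    rw [hnx]; field_simp
  have e2 : 2 * (n : ℝ) * (x ^ 6)⁻¹ ^ 3 = 2 / x ^ 2 := by
    rw [hnx]; field_simp
  have e3 : (x ^ 6)⁻¹ * x ^ 7 = x := by field_simp
  have e4 : |x ^ 7| ^ k ≤ x⁻¹ * (x ^ 8) ^ k := by
    rw [abs_of_pos (by positivity), inv_mul_eq_div, le_div_iff₀ hx0,
      show (x ^ 8) ^ k = (x ^ 7) ^ k * x ^ k by rw [← mul_pow]; ring]
    gcongr
    exact le_self_pow₀ hx1 hk
  have e5 : Real.exp (-(3 / 4 * x ^ 4)) ≤ x ^ 48 * Real.exp (-x) := by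
    have h1 : Real.exp (-(3 / 4 * x ^ 4)) ≤ Real.exp (-x) := by
      apply Real.exp_le_exp.2
      have : 8 ≤ x ^ 3 := by
        calc (8 : ℝ) = 2 ^ 3 := by norm_num
          _ ≤ x ^ 3 := by gcongr
      nlinarith
    have h2 : 1 * Real.exp (-x) ≤ x ^ 48 * Real.exp (-x) := by
      gcongr
      exact one_le_pow₀ hx1
    linarith
  have e6 : Real.exp (2 / x ^ 2) ≤ Real.exp 2 := by
    apply Real.exp_le_exp.2
    exact div_le_self (by norm_num) (one_le_pow₀ hx1)
  have e7 : 2 * (n : ℝ) + 1 ≤ 3 * x ^ 16 := by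
    have : 1 ≤ x ^ 16 := one_le_pow₀ hx1
    rw [hnx]; linarith
  have e8 : Real.exp 6 = Real.exp 1 ^ 4 * Real.exp 2 := by
    rw [← Real.exp_nat_mul, ← Real.exp_add]; norm_num
  rw [e1, e2, e3, mul_pow, hsq2, hsq]
  have e9 : (2 * (n : ℝ) + 1) * (Real.exp 1 ^ 4 * (4 * x ^ 32) * Real.exp (2 / x ^ 2)) *
      Real.exp (-x) ≤ 12 * Real.exp 6 * (x ^ 48 * Real.exp (-x)) := by
    calc _ ≤ (3 * x ^ 16) * (Real.exp 1 ^ 4 * (4 * x ^ 32) * Real.exp 2) * Real.exp (-x) := by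
          gcongr
      _ = _ := by rw [e8]; ring
  have e10 : (n : ℝ) ^ k = (x ^ 8) ^ k * x ^ (8 * k) := by
    rw [hnx]; ring
  calc _ ≤ x⁻¹ * (x ^ 8) ^ k + (n : ℝ) ^ k * (2 * (x ^ 48 * Real.exp (-x)) +
        12 * Real.exp 6 * (x ^ 48 * Real.exp (-x))) := by gcongr
    _ = _ := by rw [e10]; ring

theorem tendsto_expect_gap_pow {k : ℕ} (hk : k ≠ 0) :
    Tendsto (fun n : ℕ => Finset.expect Finset.univ (fun e : Fin (2 * n) ≃ Fin n ⊕ Fin n =>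
      Finset.expect Finset.univ (fun T : Fin (2 * n) → Bool =>
        (((maxSplitCount e : ℝ) - splitCount e (trueCount T)) / √n) ^ k))) atTop (𝓝 0) := by
  have hx : Tendsto (fun n : ℕ => (n : ℝ) ^ (1 / 16 : ℝ)) atTop atTop :=
    (tendsto_rpow_atTop (by norm_num)).comp tendsto_natCast_atTop_atTop
  have hlim : Tendsto (fun x : ℝ => x⁻¹ + (2 + 12 * Real.exp 6) *
      (x ^ (8 * k + 48) * Real.exp (-x))) atTop (𝓝 0) := by
    simpa using tendsto_inv_atTop_zero.add
      ((Real.tendsto_pow_mul_exp_neg_atTop_nhds_zero (8 * k + 48)).const_mul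
        (2 + 12 * Real.exp 6))
  refine tendsto_of_tendsto_of_tendsto_of_le_of_le' tendsto_const_nhds (hlim.comp hx) ?_ ?_
  · refine Eventually.of_forall fun n => ?_
    refine Finset.expect_nonneg fun e _ => Finset.expect_nonneg fun T _ => ?_
    have : (0 : ℝ) ≤ (maxSplitCount e : ℝ) - splitCount e (trueCount T) :=
      sub_nonneg.2 (by exact_mod_cast splitCount_le_maxSplitCount e (trueCount_le T))
    positivity
  · filter_upwards [hx.eventually_ge_atTop 2] with n hn
    refine expect_gap_pow_le_of_eq_pow hk hn ?_
    rw [← Real.rpow_natCast, ← Real.rpow_mul (by positivity)]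
    norm_num

/-! ### Characteristic functions -/

/-- The normalized maximum for an arbitrary ordering of the events. -/
noncomputable def normalizedMaxSplit {n : ℕ} (e : Fin (2 * n) ≃ Fin n ⊕ Fin n) : ℝ :=
  (√(n : ℝ))⁻¹ * ((maxSplitCount e : ℝ) - (n : ℝ) / 2)

/-- The normalized number of split items after `trueCount T` events. -/
noncomputable def normalizedSplit {n : ℕ} (e : Fin (2 * n) ≃ Fin n ⊕ Fin n)
    (T : Fin (2 * n) → Bool) : ℝ :=
  (√(n : ℝ))⁻¹ * ((splitCount e (trueCount T) : ℝ) - (n : ℝ) / 2)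

theorem normalizedMaxSplit_sub_normalizedSplit {n : ℕ} (e : Fin (2 * n) ≃ Fin n ⊕ Fin n)
    (T : Fin (2 * n) → Bool) : normalizedMaxSplit e - normalizedSplit e T =
      ((maxSplitCount e : ℝ) - splitCount e (trueCount T)) / √n := by
  unfold normalizedMaxSplit normalizedSplit
  rw [← mul_sub, sub_sub_sub_cancel_right, inv_mul_eq_div]

theorem normalizedSplit_le_normalizedMaxSplit {n : ℕ} (e : Fin (2 * n) ≃ Fin n ⊕ Fin n)
    (T : Fin (2 * n) → Bool) : normalizedSplit e T ≤ normalizedMaxSplit e := by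
  have : (0 : ℝ) ≤ (maxSplitCount e : ℝ) - splitCount e (trueCount T) :=
    sub_nonneg.2 (by exact_mod_cast splitCount_le_maxSplitCount e (trueCount_le T))
  rw [← sub_nonneg, normalizedMaxSplit_sub_normalizedSplit]
  positivity

/-- With `θ = t / (2 * √n)`, a split item contributes `exp (iθ)` and an unsplit one `exp (-iθ)`;
their average is `cos θ`. -/
theorem expect_cexp_normalizedSplit (n : ℕ) (t : ℝ) :
    Finset.expect Finset.univ (fun e : Fin (2 * n) ≃ Fin n ⊕ Fin n =>
      Finset.expect Finset.univ (fun T : Fin (2 * n) → Bool =>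
        Complex.exp (Complex.I * (t * normalizedSplit e T : ℝ)))) =
      ((Real.cos (t / (2 * √n)) ^ n : ℝ) : ℂ) := by
  have h := expect_expect_splitCount (n := n)
    (Complex.exp (-((t / (2 * √n) : ℝ) : ℂ) * Complex.I))
    (Complex.exp (((t / (2 * √n) : ℝ) : ℂ) * Complex.I))
  rw [add_comm (Complex.exp _), ← Complex.cos, ← Complex.ofReal_cos, ← Complex.ofReal_pow] at h
  rw [← h]
  refine Finset.expect_congr rfl fun e _ => Finset.expect_congr rfl fun T _ => ?_
  rw [← Complex.exp_nat_mul, ← Complex.exp_nat_mul, ← Complex.exp_add,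
    Nat.cast_sub (splitCount_le _ _)]
  congr 1
  unfold normalizedSplit
  push_cast
  ring

theorem expect_exp_normalizedSplit (n : ℕ) (s : ℝ) :
    Finset.expect Finset.univ (fun e : Fin (2 * n) ≃ Fin n ⊕ Fin n =>
      Finset.expect Finset.univ (fun T : Fin (2 * n) → Bool =>
        Real.exp (s * normalizedSplit e T))) = Real.cosh (s / (2 * √n)) ^ n := by
  have h := expect_expect_splitCount (n := n)
    (Real.exp (-(s / (2 * √n)))) (Real.exp (s / (2 * √n)))
  rw [add_comm (Real.exp _), ← Real.cosh_eq] at h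
  rw [← h]
  refine Finset.expect_congr rfl fun e _ => Finset.expect_congr rfl fun T _ => ?_
  rw [← Real.exp_nat_mul, ← Real.exp_nat_mul, ← Real.exp_add,
    Nat.cast_sub (splitCount_le _ _)]
  congr 1
  unfold normalizedSplit
  ring

theorem expect_exp_normalizedSplit_le {n : ℕ} (hn : n ≠ 0) (s : ℝ) :
    Finset.expect Finset.univ (fun e : Fin (2 * n) ≃ Fin n ⊕ Fin n =>
      Finset.expect Finset.univ (fun T : Fin (2 * n) → Bool =>
        Real.exp (s * normalizedSplit e T))) ≤ Real.exp (s ^ 2 / 8) := by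
  rw [expect_exp_normalizedSplit]
  have hn' : (0 : ℝ) < n := by positivity
  calc _ ≤ Real.exp ((s / (2 * √n)) ^ 2 / 2) ^ n := by
        gcongr
        exact Real.cosh_le_exp_half_sq _
    _ = _ := by
        rw [← Real.exp_nat_mul, div_pow, mul_pow, Real.sq_sqrt hn'.le]
        congr 1
        field_simp
        norm_num

theorem tendsto_cos_div_sqrt_pow (t : ℝ) :
    Tendsto (fun n : ℕ => Real.cos (t / (2 * √n)) ^ n) atTop (𝓝 (Real.exp (-(t ^ 2 / 8)))) := by
  have h1 : ∀ x : ℝ, Real.cos x = 1 + -(2 * Real.sin (x / 2) ^ 2) := by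
    intro x
    rw [Real.sin_sq_eq_half_sub]
    ring_nf
  simp_rw [h1]
  refine Real.tendsto_one_add_pow_exp_of_tendsto ?_
  -- This is the derivative of `sin (t / 4 * x)` at `0`, along `x = 1 / √n`.
  have hsin : Tendsto (fun n : ℕ => √n * Real.sin (t / 4 * (√n)⁻¹)) atTop (𝓝 (t / 4)) := by
    have hd : HasDerivAt (fun x : ℝ => Real.sin (t / 4 * x)) (t / 4) 0 := by
      have := ((hasDerivAt_id (0 : ℝ)).const_mul (t / 4)).sin
      simpa using this
    have hs : Tendsto (fun n : ℕ => (√(n : ℝ))⁻¹) atTop (𝓝[>] 0) :=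
      tendsto_inv_atTop_nhdsGT_zero.comp
        (Real.tendsto_sqrt_atTop.comp tendsto_natCast_atTop_atTop)
    have h2 := (hasDerivAt_iff_tendsto_slope_zero.1 hd).comp
      (hs.mono_right (nhdsWithin_mono _ fun x hx => ne_of_gt hx))
    simpa [Function.comp_def] using h2
  have h3 := (hsin.pow 2).const_mul (-2)
  have e1 : -2 * (t / 4) ^ 2 = -(t ^ 2 / 8) := by ring
  rw [e1] at h3
  refine h3.congr fun n => ?_
  rw [mul_pow, Real.sq_sqrt (by positivity), show t / (2 * √n) / 2 = t / 4 * (√n)⁻¹ by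
    rw [div_div, div_eq_mul_inv, mul_inv, mul_inv]; ring]
  ring

/-- Since `x ↦ exp (itx)` is `|t|`-Lipschitz, the first moment of the gap controls the difference
from the value at the random time. -/
theorem tendsto_expect_cexp_normalizedMaxSplit (t : ℝ) :
    Tendsto (fun n : ℕ => Finset.expect Finset.univ (fun e : Fin (2 * n) ≃ Fin n ⊕ Fin n =>
      Complex.exp (Complex.I * (t * normalizedMaxSplit e : ℝ)))) atTop
      (𝓝 ((Real.exp (-(t ^ 2 / 8)) : ℝ) : ℂ)) := by
  have h1 : Tendsto (fun n : ℕ => ((Real.cos (t / (2 * √n)) ^ n : ℝ) : ℂ)) atTop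
      (𝓝 ((Real.exp (-(t ^ 2 / 8)) : ℝ) : ℂ)) :=
    (Complex.continuous_ofReal.tendsto _).comp (tendsto_cos_div_sqrt_pow t)
  have h2 : Tendsto (fun n : ℕ => Finset.expect Finset.univ
      (fun e : Fin (2 * n) ≃ Fin n ⊕ Fin n =>
        Complex.exp (Complex.I * (t * normalizedMaxSplit e : ℝ))) -
        ((Real.cos (t / (2 * √n)) ^ n : ℝ) : ℂ)) atTop (𝓝 0) := by
    have h3 := (tendsto_expect_gap_pow one_ne_zero).const_mul |t|
    rw [mul_zero] at h3
    refine squeeze_zero_norm (fun n => ?_) h3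
    rw [← expect_cexp_normalizedSplit]
    have h4 : ∀ e : Fin (2 * n) ≃ Fin n ⊕ Fin n,
        Complex.exp (Complex.I * (t * normalizedMaxSplit e : ℝ)) =
        Finset.expect Finset.univ (fun _ : Fin (2 * n) → Bool =>
          Complex.exp (Complex.I * (t * normalizedMaxSplit e : ℝ))) :=
      fun e => (Fintype.expect_const _).symm
    rw [Finset.expect_congr rfl fun e _ => h4 e, ← Finset.expect_sub_distrib]
    simp_rw [← Finset.expect_sub_distrib, Finset.mul_expect]
    refine (RCLike.norm_expect_le (K := ℂ)).trans (Finset.expect_le_expect fun e _ => ?_)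
    refine (RCLike.norm_expect_le (K := ℂ)).trans (Finset.expect_le_expect fun T _ => ?_)
    rw [pow_one, ← normalizedMaxSplit_sub_normalizedSplit]
    have h5 : Complex.exp (Complex.I * (t * normalizedMaxSplit e : ℝ)) -
        Complex.exp (Complex.I * (t * normalizedSplit e T : ℝ)) =
        Complex.exp (Complex.I * (t * normalizedSplit e T : ℝ)) *
          (Complex.exp (Complex.I * (t * (normalizedMaxSplit e - normalizedSplit e T) : ℝ)) - 1) := by
      rw [mul_sub, ← Complex.exp_add, mul_one]
      congr 2
      push_cast
      ring
    rw [h5, norm_mul, Complex.norm_exp_I_mul_ofReal, one_mul]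
    refine (Real.norm_exp_I_mul_ofReal_sub_one_le).trans (le_of_eq ?_)
    rw [Real.norm_eq_abs, abs_mul,
      abs_of_nonneg (sub_nonneg.2 (normalizedSplit_le_normalizedMaxSplit e T))]
  simpa using h2.add h1

/-! ### Bounded even moments -/

theorem pow_two_mul_le_factorial_mul_exp_add_exp (x : ℝ) (k : ℕ) :
    x ^ (2 * k) ≤ (2 * k).factorial * (Real.exp (1 * x) + Real.exp (-1 * x)) := by
  have h1 := Real.pow_div_factorial_le_exp |x| (abs_nonneg x) (2 * k)
  rw [div_le_iff₀ (by positivity), (even_two_mul k).pow_abs, mul_comm (Real.exp _)] at h1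
  rw [one_mul, neg_one_mul]
  refine h1.trans ?_
  gcongr
  exact Real.exp_abs_le x

/-- The maximum is the value at the random time plus the gap: the first has subgaussian exponential
moments, the second has vanishing moments. -/
theorem eventually_expect_normalizedMaxSplit_pow_le (k : ℕ) :
    ∃ C : ℝ, ∀ᶠ n : ℕ in atTop,
      Finset.expect Finset.univ (fun e : Fin (2 * n) ≃ Fin n ⊕ Fin n =>
        normalizedMaxSplit e ^ (2 * k)) ≤ C := by
  rcases eq_or_ne k 0 with rfl | hk
  · exact ⟨1, Eventually.of_forall fun n => by simp⟩
  refine ⟨2 ^ (2 * k - 1) * ((2 * k).factorial * (Real.exp (1 ^ 2 / 8) +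
    Real.exp ((-1) ^ 2 / 8)) + 1), ?_⟩
  have h1 := tendsto_expect_gap_pow (k := 2 * k) (by omega)
  filter_upwards [h1.eventually_le_const zero_lt_one, eventually_ne_atTop 0] with n hn hn0
  have h2 : ∀ e : Fin (2 * n) ≃ Fin n ⊕ Fin n, normalizedMaxSplit e ^ (2 * k) =
      Finset.expect Finset.univ (fun _ : Fin (2 * n) → Bool => normalizedMaxSplit e ^ (2 * k)) :=
    fun e => (Fintype.expect_const _).symm
  rw [Finset.expect_congr rfl fun e _ => h2 e]
  have h3 : ∀ (e : Fin (2 * n) ≃ Fin n ⊕ Fin n) (T : Fin (2 * n) → Bool),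
      normalizedMaxSplit e ^ (2 * k) ≤ 2 ^ (2 * k - 1) * ((2 * k).factorial *
        (Real.exp (1 * normalizedSplit e T) + Real.exp (-1 * normalizedSplit e T)) +
        (((maxSplitCount e : ℝ) - splitCount e (trueCount T)) / √n) ^ (2 * k)) := by
    intro e T
    have h4 := (even_two_mul k).add_pow_le (a := normalizedSplit e T)
      (b := ((maxSplitCount e : ℝ) - splitCount e (trueCount T)) / √n)
    rw [← normalizedMaxSplit_sub_normalizedSplit, add_sub_cancel] at h4
    refine h4.trans ?_
    rw [normalizedMaxSplit_sub_normalizedSplit]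
    gcongr
    exact pow_two_mul_le_factorial_mul_exp_add_exp _ _
  refine (Finset.expect_le_expect fun e _ => Finset.expect_le_expect fun T _ => h3 e T).trans ?_
  simp_rw [← Finset.mul_expect, Finset.expect_add_distrib, ← Finset.mul_expect,
    Finset.expect_add_distrib]
  gcongr
  · exact expect_exp_normalizedSplit_le hn0 1
  · exact expect_exp_normalizedSplit_le hn0 (-1)

/-! ### Return to admissible sequences -/

theorem integral_law_eq_expect {n : ℕ} {𝕜 : Type*} [RCLike 𝕜] (f : EventSequence n → 𝕜) :
    ∫ ω, f ω ∂(EventSequence.law n) = Finset.expect Finset.univ f := by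
  rw [integral_fintype Integrable.of_finite, Fintype.expect_eq_sum_div_card, Finset.sum_div]
  refine Finset.sum_congr rfl fun ω _ => ?_
  rw [EventSequence.law, measureReal_def, uniformOn_univ, Measure.count_singleton, one_div,
    ENNReal.toReal_inv, ENNReal.toReal_natCast, RCLike.real_smul_eq_coe_mul, div_eq_inv_mul]
  push_cast
  rfl

theorem integral_normalizedMax_eq_expect {n : ℕ} {𝕜 : Type*} [RCLike 𝕜] (f : ℝ → 𝕜) :
    ∫ ω, f ω.normalizedMax ∂(EventSequence.law n) =
      Finset.expect Finset.univ (fun e : Fin (2 * n) ≃ Fin n ⊕ Fin n =>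
        f (normalizedMaxSplit e)) := by
  have h1 : ∀ ω : EventSequence n, ω.normalizedMax = normalizedMaxSplit ω.1 := by
    intro ω
    unfold EventSequence.normalizedMax normalizedMaxSplit
    rw [ω.maxQueueSize_eq_maxSplitCount]
    push_cast
    rfl
  simp_rw [integral_law_eq_expect, h1]
  refine expect_eventSequence_eq_expect_equiv (fun e => f (normalizedMaxSplit e)) fun e s => ?_
  have h2 : maxSplitCount (e.trans (exchangeEvents s)) = maxSplitCount e := by
    unfold maxSplitCount
    congr 1
    funext m
    exact splitCount_trans_exchangeEvents e s m
  simp only [normalizedMaxSplit, h2]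

/-! ### Convergence of integrals by truncation -/

/-- Truncation of a real number to `[-K, K]`. -/
noncomputable def truncateReal (K x : ℝ) : ℝ := max (-K) (min x K)

theorem continuous_truncateReal (K : ℝ) : Continuous (truncateReal K) := by
  unfold truncateReal; fun_prop

theorem abs_truncateReal_le {K : ℝ} (hK : 0 < K) (x : ℝ) : |truncateReal K x| ≤ K := by
  unfold truncateReal
  rw [abs_le]
  exact ⟨le_max_left _ _, max_le (by linarith) (min_le_right _ _)⟩

/-- The error vanishes for `|x| ≤ K`; otherwise it is at most `|x| ≤ x ^ 2 / K`. -/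
theorem abs_sub_truncateReal_le {K : ℝ} (hK : 0 < K) (x : ℝ) :
    |x - truncateReal K x| ≤ x ^ 2 / K := by
  rw [le_div_iff₀ hK]
  unfold truncateReal
  rcases le_total x K with h | h
  · rw [min_eq_left h]
    rcases le_total (-K) x with h' | h'
    · rw [max_eq_right h', sub_self, abs_zero, zero_mul]
      positivity
    · rw [max_eq_left h', abs_of_nonpos (by linarith)]
      nlinarith
  · rw [min_eq_right h, max_eq_right (by linarith), abs_of_nonneg (by linarith)]
    nlinarith

theorem abs_integral_sub_integral_truncateReal_le {Ω : Type*} [MeasurableSpace Ω] {μ : Measure Ω}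
    [IsProbabilityMeasure μ] {g : Ω → ℝ} (hg : Integrable g μ)
    (hg2 : Integrable (fun ω => g ω ^ 2) μ) {K : ℝ} (hK : 0 < K) :
    |∫ ω, g ω ∂μ - ∫ ω, truncateReal K (g ω) ∂μ| ≤ (∫ ω, g ω ^ 2 ∂μ) / K := by
  have ht : Integrable (fun ω => truncateReal K (g ω)) μ :=
    Integrable.of_bound ((continuous_truncateReal K).comp_aestronglyMeasurable
      hg.aestronglyMeasurable) K (Eventually.of_forall fun ω => abs_truncateReal_le hK _)
  rw [← integral_sub hg ht, ← integral_div]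
  refine abs_integral_le_integral_abs.trans
    (integral_mono (hg.sub ht).abs (hg2.div_const K) fun ω => abs_sub_truncateReal_le hK _)

/-- Convergence in distribution and bounded second moments of `f` imply convergence of the
integrals of the continuous function `f`. -/
theorem tendsto_integral_comp_of_tendstoInDistribution {Ω : ℕ → Type*} {Ω' : Type*}
    [∀ n, MeasurableSpace (Ω n)] [MeasurableSpace Ω'] {μ : ∀ n, Measure (Ω n)} {ν : Measure Ω'}
    [∀ n, IsProbabilityMeasure (μ n)] [IsProbabilityMeasure ν] {X : ∀ n, Ω n → ℝ} {Z : Ω' → ℝ}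
    (h : TendstoInDistribution X atTop Z μ ν) {f : ℝ → ℝ} (hf : Continuous f)
    (hX : ∀ n, Integrable (fun ω => f (X n ω)) (μ n))
    (hX2 : ∀ n, Integrable (fun ω => f (X n ω) ^ 2) (μ n))
    (hZ : Integrable (fun ω => f (Z ω)) ν) (hZ2 : Integrable (fun ω => f (Z ω) ^ 2) ν)
    {C : ℝ} (hC : ∀ᶠ n in atTop, ∫ ω, f (X n ω) ^ 2 ∂(μ n) ≤ C) :
    Tendsto (fun n => ∫ ω, f (X n ω) ∂(μ n)) atTop (𝓝 (∫ ω, f (Z ω) ∂ν)) := by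
  rw [Metric.tendsto_atTop']
  intro ε hε
  set B := max 1 (max C (∫ ω, f (Z ω) ^ 2 ∂ν)) with hB
  have hB0 : 0 < B := lt_of_lt_of_le one_pos (le_max_left _ _)
  -- Each of the two truncation errors is then at most `ε / 4`, and the bounded part supplies
  -- another `ε / 4`.
  set K := 4 * B / ε with hKdef
  have hK : 0 < K := by positivity
  have hBK : B / K = ε / 4 := by rw [hKdef]; field_simp
  have htr : Tendsto (fun n => ∫ ω, truncateReal K (f (X n ω)) ∂(μ n)) atTop
      (𝓝 (∫ ω, truncateReal K (f (Z ω)) ∂ν)) := by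
    let φ : BoundedContinuousFunction ℝ ℝ := BoundedContinuousFunction.ofNormedAddCommGroup
      (fun x => truncateReal K (f x)) ((continuous_truncateReal K).comp hf) K
      fun x => abs_truncateReal_le hK _
    have h1 := ProbabilityMeasure.tendsto_iff_forall_integral_tendsto.1 h.tendsto φ
    simp only [ProbabilityMeasure.coe_mk] at h1
    rw [integral_map h.aemeasurable_limit φ.continuous.aestronglyMeasurable] at h1
    refine h1.congr fun n => ?_
    rw [integral_map (h.forall_aemeasurable n) φ.continuous.aestronglyMeasurable]
    rfl
  have h2 := (Metric.tendsto_nhds.1 htr (ε / 4) (by positivity)).and hC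
  obtain ⟨N, hN⟩ := eventually_atTop.1 h2
  refine ⟨N, fun n hn => ?_⟩
  obtain ⟨h3, h4⟩ := hN n hn.le
  have h5 := abs_integral_sub_integral_truncateReal_le (hX n) (hX2 n) hK
  have h6 := abs_integral_sub_integral_truncateReal_le hZ hZ2 hK
  have h7 : (∫ ω, f (X n ω) ^ 2 ∂(μ n)) / K ≤ ε / 4 := by
    rw [← hBK]; gcongr; exact h4.trans ((le_max_left _ _).trans (le_max_right _ _))
  have h8 : (∫ ω, f (Z ω) ^ 2 ∂ν) / K ≤ ε / 4 := by
    rw [← hBK]; gcongr; exact (le_max_right _ _).trans (le_max_right _ _)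
  rw [Real.dist_eq] at h3 ⊢
  rw [abs_lt] at h3 ⊢
  rw [abs_le] at h5 h6
  constructor <;> linarith [h3.1, h3.2, h5.1, h5.2, h6.1, h6.2]

/-! ### Limit law and moments of the normalized maximum -/

theorem tendstoInDistribution_normalizedMax : TendstoInDistribution
    (fun (n : ℕ) (ω : EventSequence n) => ω.normalizedMax) atTop
    (id : ℝ → ℝ) (fun n => EventSequence.law n) (gaussianReal 0 (1 / 4)) where
  forall_aemeasurable n := (measurable_of_finite _).aemeasurable
  tendsto := by
    refine ProbabilityMeasure.tendsto_iff_tendsto_charFun.2 fun t => ?_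
    simp only [ProbabilityMeasure.coe_mk, Measure.map_id]
    rw [charFun_gaussianReal]
    have h := tendsto_expect_cexp_normalizedMaxSplit t
    have e1 : ((Real.exp (-(t ^ 2 / 8)) : ℝ) : ℂ) =
        Complex.exp (t * (0 : ℝ) * Complex.I - ((1 / 4 : NNReal) : ℝ) * t ^ 2 / 2) := by
      push_cast
      congr 1
      ring
    rw [e1] at h
    refine h.congr fun n => ?_
    rw [charFun_apply_real, integral_map (measurable_of_finite _).aemeasurable
      (by fun_prop), ← integral_normalizedMax_eq_expect
        (fun x : ℝ => Complex.exp (Complex.I * (t * x : ℝ)))]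
    refine integral_congr_ae (Eventually.of_forall fun ω => ?_)
    simp only
    congr 1
    push_cast
    ring

theorem integrable_law {n : ℕ} (f : EventSequence n → ℝ) :
    Integrable f (EventSequence.law n) := Integrable.of_finite

theorem eventually_integral_normalizedMax_pow_le (k : ℕ) :
    ∃ C : ℝ, ∀ᶠ n : ℕ in atTop,
      ∫ ω : EventSequence n, ω.normalizedMax ^ (2 * k) ∂(EventSequence.law n) ≤ C := by
  obtain ⟨C, hC⟩ := eventually_expect_normalizedMaxSplit_pow_le k
  refine ⟨C, hC.mono fun n hn => ?_⟩
  rwa [integral_normalizedMax_eq_expect (fun x : ℝ => x ^ (2 * k))]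

theorem integrable_pow_gaussianReal (μ : ℝ) (v : NNReal) (k : ℕ) :
    Integrable (fun x : ℝ => x ^ k) (gaussianReal μ v) := by
  have h : MemLp id (k : ENNReal) (gaussianReal μ v) := by
    simpa using memLp_id_gaussianReal (μ := μ) (v := v) (k : NNReal)
  have h2 := h.integrable_norm_pow'
  simp_rw [← norm_pow] at h2
  exact (integrable_norm_iff (by fun_prop)).1 h2

theorem tendsto_integral_comp_normalizedMax {f : ℝ → ℝ} (hf : Continuous f) {k : ℕ}
    (hfk : ∀ x, f x ^ 2 ≤ 1 + x ^ (2 * k)) :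
    Tendsto (fun n : ℕ => ∫ ω : EventSequence n, f ω.normalizedMax ∂(EventSequence.law n))
      atTop (𝓝 (∫ x : ℝ, f x ∂(gaussianReal 0 (1 / 4)))) := by
  obtain ⟨C, hC⟩ := eventually_integral_normalizedMax_pow_le k
  have hk : Integrable (fun x : ℝ => 1 + x ^ (2 * k)) (gaussianReal 0 (1 / 4)) :=
    (integrable_const 1).add (integrable_pow_gaussianReal _ _ _)
  have hZ2 : Integrable (fun x : ℝ => f x ^ 2) (gaussianReal 0 (1 / 4)) :=
    hk.mono' (by fun_prop) (Eventually.of_forall fun x => by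
      rw [Real.norm_eq_abs, abs_of_nonneg (sq_nonneg _)]; exact hfk x)
  have hZ : Integrable f (gaussianReal 0 (1 / 4)) :=
    ((memLp_two_iff_integrable_sq hf.aestronglyMeasurable).2 hZ2).integrable one_le_two
  refine tendsto_integral_comp_of_tendstoInDistribution tendstoInDistribution_normalizedMax hf
    (fun n => integrable_law _) (fun n => integrable_law _) hZ hZ2 (C := 1 + C) ?_
  filter_upwards [hC] with n hn
  calc _ ≤ ∫ ω : EventSequence n, (1 + ω.normalizedMax ^ (2 * k)) ∂(EventSequence.law n) :=
        integral_mono (integrable_law _) (integrable_law _) fun ω => hfk _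
    _ = 1 + ∫ ω : EventSequence n, ω.normalizedMax ^ (2 * k) ∂(EventSequence.law n) := by
        rw [integral_add (integrable_law _) (integrable_law _)]; simp
    _ ≤ 1 + C := by gcongr

theorem tendsto_integral_normalizedMax_pow (r : ℕ) :
    Tendsto (fun n : ℕ => ∫ ω : EventSequence n, ω.normalizedMax ^ r ∂(EventSequence.law n))
      atTop (𝓝 (∫ x : ℝ, x ^ r ∂(gaussianReal 0 (1 / 4)))) :=
  tendsto_integral_comp_normalizedMax (f := fun x => x ^ r) (by fun_prop) (k := r) fun x => by
    rw [← pow_mul, mul_comm]; linarith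

theorem tendsto_integral_abs_normalizedMax_rpow {s : ℝ} (hs : 0 < s) :
    Tendsto (fun n : ℕ => ∫ ω : EventSequence n, |ω.normalizedMax| ^ s ∂(EventSequence.law n))
      atTop (𝓝 (∫ x : ℝ, |x| ^ s ∂(gaussianReal 0 (1 / 4)))) := by
  refine tendsto_integral_comp_normalizedMax (f := fun x => |x| ^ s)
    (continuous_abs.rpow_const fun x => Or.inr hs.le) (k := ⌈s⌉₊) fun x => ?_
  rw [← (even_two_mul ⌈s⌉₊).pow_abs, mul_comm, pow_mul]
  have hx : 0 ≤ |x| := abs_nonneg x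
  -- The constant `1` dominates where `|x| ≤ 1`, the power with exponent `⌈s⌉₊` elsewhere.
  rcases le_total |x| 1 with h | h
  · have h1 : |x| ^ s ≤ 1 := Real.rpow_le_one hx h hs.le
    have h2 : (|x| ^ s) ^ 2 ≤ 1 := pow_le_one₀ (by positivity) h1
    have h3 : 0 ≤ (|x| ^ ⌈s⌉₊) ^ 2 := by positivity
    linarith
  · have h1 : |x| ^ s ≤ |x| ^ ⌈s⌉₊ := by
      rw [← Real.rpow_natCast]
      exact Real.rpow_le_rpow_of_exponent_le h (Nat.le_ceil s)
    have h2 : (|x| ^ s) ^ 2 ≤ (|x| ^ ⌈s⌉₊) ^ 2 := by gcongr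
    linarith

/-! ### Mean and variance of the maximum queue size -/

theorem maxQueueSize_eq_sqrt_mul_normalizedMax {n : ℕ} (hn : n ≠ 0) (ω : EventSequence n) :
    (ω.maxQueueSize : ℝ) = √n * ω.normalizedMax + n / 2 := by
  have : √(n : ℝ) ≠ 0 := by positivity
  rw [EventSequence.normalizedMax, mul_inv_cancel_left₀ this, sub_add_cancel]

theorem tendsto_integral_normalizedMax :
    Tendsto (fun n : ℕ => ∫ ω : EventSequence n, ω.normalizedMax ∂(EventSequence.law n))
      atTop (𝓝 0) := by
  simpa [integral_id_gaussianReal] using tendsto_integral_normalizedMax_pow 1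

theorem tendsto_variance_normalizedMax :
    Tendsto (fun n : ℕ => variance (fun ω : EventSequence n => ω.normalizedMax)
      (EventSequence.law n)) atTop (𝓝 (1 / 4)) := by
  have h2 := tendsto_integral_normalizedMax_pow 2
  have hg : ∫ x : ℝ, x ^ 2 ∂(gaussianReal 0 (1 / 4)) = 1 / 4 := by
    have h := variance_id_gaussianReal (μ := 0) (v := 1 / 4)
    rw [variance_eq_integral aemeasurable_id] at h
    simpa [integral_id_gaussianReal] using h
  rw [hg] at h2
  have h := h2.sub (tendsto_integral_normalizedMax.pow 2)
  rw [zero_pow two_ne_zero, sub_zero] at h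
  refine h.congr fun n => ?_
  rw [variance_eq_sub (MemLp.of_discrete)]
  rfl

theorem integral_maxQueueSize_sub_isLittleO :
    (fun n : ℕ =>
      (∫ ω : EventSequence n, (ω.maxQueueSize : ℝ) ∂(EventSequence.law n)) - (n : ℝ) / 2)
      =o[atTop] (fun n : ℕ => √(n : ℝ)) := by
  rw [isLittleO_iff_tendsto' (by
    filter_upwards [eventually_ne_atTop 0] with n hn h
    have : √(n : ℝ) ≠ 0 := by positivity
    exact absurd h this)]
  refine tendsto_integral_normalizedMax.congr' ?_
  filter_upwards [eventually_ne_atTop 0] with n hn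
  have h0 : √(n : ℝ) ≠ 0 := by positivity
  simp_rw [maxQueueSize_eq_sqrt_mul_normalizedMax hn]
  rw [integral_add (integrable_law _) (integrable_law _), integral_const_mul]
  simp only [integral_const, probReal_univ, one_smul, add_sub_cancel_right]
  rw [mul_div_cancel_left₀ _ h0]

theorem variance_maxQueueSize_sub_isLittleO :
    (fun n : ℕ =>
      variance (fun ω : EventSequence n => (ω.maxQueueSize : ℝ)) (EventSequence.law n)
        - (n : ℝ) / 4) =o[atTop] (fun n : ℕ => (n : ℝ)) := by
  rw [isLittleO_iff_tendsto' (by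
    filter_upwards [eventually_ne_atTop 0] with n hn h
    exact absurd h (by positivity))]
  have h := tendsto_variance_normalizedMax.sub_const (1 / 4)
  rw [sub_self] at h
  refine h.congr' ?_
  filter_upwards [eventually_ne_atTop 0] with n hn
  have h0 : (n : ℝ) ≠ 0 := by positivity
  simp_rw [maxQueueSize_eq_sqrt_mul_normalizedMax hn]
  rw [variance_add_const (measurable_of_finite _).aestronglyMeasurable, variance_const_mul,
    Real.sq_sqrt (by positivity)]
  field_simp
theorem mainTheorem11 :
    TendstoInDistribution
        (fun (n : ℕ) (ω : EventSequence n) => ω.normalizedMax) atTop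
        (id : ℝ → ℝ) (fun n => EventSequence.law n) (gaussianReal 0 (1 / 4)) ∧
      (∀ r : ℕ,
        Tendsto (fun n : ℕ => ∫ ω : EventSequence n, ω.normalizedMax ^ r ∂(EventSequence.law n))
          atTop (𝓝 (∫ x : ℝ, x ^ r ∂(gaussianReal 0 (1 / 4))))) ∧
      (∀ s : ℝ, 0 < s →
        Tendsto (fun n : ℕ => ∫ ω : EventSequence n, |ω.normalizedMax| ^ s ∂(EventSequence.law n))
          atTop (𝓝 (∫ x : ℝ, |x| ^ s ∂(gaussianReal 0 (1 / 4))))) ∧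
      (fun n : ℕ =>
          (∫ ω : EventSequence n, (ω.maxQueueSize : ℝ) ∂(EventSequence.law n)) - (n : ℝ) / 2)
        =o[atTop] (fun n : ℕ => √(n : ℝ)) ∧
      (fun n : ℕ =>
          variance (fun ω : EventSequence n => (ω.maxQueueSize : ℝ)) (EventSequence.law n)
            - (n : ℝ) / 4)
        =o[atTop] (fun n : ℕ => (n : ℝ)) :=
  ⟨tendstoInDistribution_normalizedMax, tendsto_integral_normalizedMax_pow,
    fun _ hs => tendsto_integral_abs_normalizedMax_rpow hs,
    integral_maxQueueSize_sub_isLittleO, variance_maxQueueSize_sub_isLittleO⟩
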